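/- Let $n\ge 1$ be an integer and let $\nu>-1$ be real with $\nu\neq 0$. Let $$p(z)=F(-n,\nu+2;-n-\nu+1;z)=\sum_{k=0}^n \frac{(-n)_k(\nu+2)_k}{(-n-\nu+1)_k}\frac{z^k}{k!},$$ where $(a)_0=1$ and $(a)_k=a(a+1)\cdots(a+k-1)$ for $k\ge 1$; let $q$ be its conjugate-reciprocal polynomial, $q(z)=z^n\overline{p(1/\bar z)}$, and let $B=p/q$, denoted $B(-n,\nu+2;-n-\nu+1;z)$. Write $\mathbb T=\{z\in\mathbb C:|z|=1\}$. Then $B$ is a hypergeometric Blaschke product of degree $n$: the denominators $(-n-\nu+1)_k$, $0\le k\le n$, do not vanish, all zeros of $p$ lie in the open unit disk, and $B(z)=\alpha\prod_{k=1}^n\frac{z-a_k}{1-\overline{a_k}z}$ for some $|\alpha|=1$ and $|a_k|<1$. With $M(B)=\sup_{|z|=1}|B'(z)|$ and $m(B)=\inf_{|z|=1}|B'(z)|$, it has the following properties: $$M(B)=n+\nu,\quad m(B)=\frac{n}{\nu+1}\qquad\text{if }\nu>0,$$ $$M(B)=\frac{n}{\nu+1},\quad m(B)=n+\nu\qquad\text{if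 }-1<\nu<0.$$ Both extremes are attained within the set $\mathcal E=\{z\in\mathbb T: zB(z)=1\}$, that is, $|B'|=M(B)$ at some point of $\mathcal E$ and $|B'|=m(B)$ at some point of $\mathcal E$. Specifically, $|B'(z)|=n+\nu$ for every $z\in\mathcal E\setminus\{1\}$, while $1\in\mathcal E$ and $|B'(1)|=n/(\nu+1)$. -/

import Mathlib

noncomputable section

/-- `B` is a finite Blaschke product of degree `n`: a unimodular constant times a product of `n`
Möbius factors `(z - a) / (1 - conj a * z)` with `a` in the open unit disk. (With `x / 0 = 0`,
both sides are compared also at the poles, where the right-hand side is `0`.) -/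
def IsBlaschkeProduct (n : ℕ) (B : ℂ → ℂ) : Prop :=
  ∃ (α : ℂ) (a : Fin n → ℂ), ‖α‖ = 1 ∧ (∀ k, ‖a k‖ < 1) ∧
    ∀ z, B z = α * ∏ k, (z - a k) / (1 - starRingEnd ℂ (a k) * z)

/-- `M(B)`, the supremum of `|B'|` over the unit circle. -/
def maxDeriv (B : ℂ → ℂ) : ℝ :=
  sSup ((fun z => ‖deriv B z‖) '' Metric.sphere (0 : ℂ) 1)

/-- `m(B)`, the infimum of `|B'|` over the unit circle. -/
def minDeriv (B : ℂ → ℂ) : ℝ :=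
  sInf ((fun z => ‖deriv B z‖) '' Metric.sphere (0 : ℂ) 1)

/-- The hypergeometric polynomial `F(-n, b; c; z)`, whose `k`-th coefficient is
`(-n)_k (b)_k / ((c)_k k!)`. -/
def hyperPoly (n : ℕ) (b c : ℂ) : Polynomial ℂ :=
  ∑ k ∈ Finset.range (n + 1),
    Polynomial.monomial k (ordinaryHypergeometricCoefficient (-(n : ℂ)) b c k)

/-- The polynomial `hyperPoly n b c` is the (terminating) Gauss hypergeometric series. -/
theorem eval_hyperPoly (n : ℕ) (b c z : ℂ) :
    (hyperPoly n b c).eval z = ₂F₁ (-(n : ℂ)) b c z := by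
  rw [ordinaryHypergeometric_eq_tsum, hyperPoly, Polynomial.eval_finsetSum]
  beta_reduce
  rw [tsum_eq_sum (s := Finset.range (n + 1))]
  · refine Finset.sum_congr rfl fun k _ => ?_
    simp [ordinaryHypergeometricCoefficient, Polynomial.eval_monomial]
  · intro k hk
    have hk' : n < k := by simpa [Nat.lt_succ_iff] using hk
    have h0 : (ascPochhammer ℂ k).eval (-(n : ℂ)) = 0 :=
      (ascPochhammer_eval_eq_zero_iff k _).2 ⟨n, hk', by simp⟩
    simp [h0]

/-- The conjugate-reciprocal polynomial `q(z) = z ^ n * conj (p (1 / conj z))` of a polynomial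
`p` of degree at most `n`. -/
def conjReciprocal (n : ℕ) (p : Polynomial ℂ) : Polynomial ℂ :=
  (p.map (starRingEnd ℂ)).reflect n

theorem eval_conjReciprocal (n : ℕ) (p : Polynomial ℂ) (hp : p.natDegree ≤ n) {z : ℂ}
    (hz : z ≠ 0) :
    (conjReciprocal n p).eval z
      = z ^ n * starRingEnd ℂ (p.eval (1 / starRingEnd ℂ z)) := by
  have hd : (p.map (starRingEnd ℂ)).natDegree ≤ n :=
    (Polynomial.natDegree_map_le).trans hp
  have hi : Invertible z⁻¹ := invertibleOfNonzero (inv_ne_zero hz)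
  have h := Polynomial.eval₂_reflect_mul_pow (RingHom.id ℂ) z⁻¹ n _ hd
  rw [invOf_eq_inv, inv_inv, Polynomial.eval₂_id, Polynomial.eval₂_id] at h
  have h2 : starRingEnd ℂ (p.eval (1 / starRingEnd ℂ z))
      = (p.map (starRingEnd ℂ)).eval z⁻¹ := by
    have := Polynomial.eval_map_apply (p := p) (f := starRingEnd ℂ) (x := 1 / starRingEnd ℂ z)
    rw [← this]
    simp
  rw [h2, ← h, conjReciprocal, mul_left_comm, ← mul_pow, mul_inv_cancel₀ hz, one_pow, mul_one]

/-- The quotient `B(-n, b; c; z) = p(z) / q(z)`, where `p(z) = F(-n, b; c; z)` and `q` is the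
conjugate-reciprocal polynomial of `p`. -/
def hyperBlaschke (n : ℕ) (b c : ℂ) (z : ℂ) : ℂ :=
  (hyperPoly n b c).eval z / (conjReciprocal n (hyperPoly n b c)).eval z

/-- `B(-n, b; c; z)` is a hypergeometric Blaschke product: the parameter `c` is admissible, all
zeros of the hypergeometric polynomial lie in the open unit disk, and the quotient is a Blaschke
product of degree `n`. -/
structure IsHyperBlaschke (n : ℕ) (b c : ℂ) : Prop where
  admissible : ∀ k < n, c ≠ -(k : ℂ)
  zeros : ∀ z, (hyperPoly n b c).eval z = 0 → ‖z‖ < 1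
  blaschke : IsBlaschkeProduct n (hyperBlaschke n b c)

/-- The set of points `z` of the unit circle with `z * B z = 1`. -/
def extremeSet (B : ℂ → ℂ) : Set ℂ :=
  {z | z ∈ Metric.sphere (0 : ℂ) 1 ∧ z * B z = 1}

end

/-! Put `l = ν + 1` and `n = m + 1`. Up to the nonzero real factor `(ν)_n`, the hypergeometric
polynomial is `P`, built from a Szegő pair `S`, `V`; its reciprocal is `Q`, so `B = P / Q`. Two
polynomial identities carry the theorem. `X_mul_P_sub_Q` says that `zB = 1` on the circle exactly at
`1` and at the zeros of `G = zS + V`. `wronskian_P_Q` writes the numerator of `zB'` as a combination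
of `PQ` and `G²`. On the circle these are `z ^ n` times `|P|²` and `|G|²`, so `|B'| = (1 - t)(n + ν)
+ t n / (ν + 1)` with `t = l²|G|² / |P|²`. A further identity, `P_mul_Q_sub`, with the positivity of
the Wronskian `W`, gives `t ≤ 1` (`norm_G_le_norm_P`). Since `P(1) = l G(1)`, `t = 1` at `1`, while
`t = 0` at the zeros of `G`; `exists_root_G` supplies such a zero on the circle. The sign of `ν`
decides which endpoint is the larger. -/

open Polynomial in
/-- The circular Jacobi polynomial of degree `m` with parameter `l` (orthogonal on the unit circle,
unnormalised), paired with its conjugate-reciprocal polynomial, generated by the Szegő recursion. -/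
noncomputable def circularJacobi (l : ℝ) : ℕ → ℂ[X] × ℂ[X]
  | 0 => (1, 1)
  | m + 1 => (C ((l : ℂ) + m + 1) * (X * (circularJacobi l m).1) + C (l : ℂ) * (circularJacobi l m).2,
      C ((l : ℂ) + m + 1) * (circularJacobi l m).2 + C (l : ℂ) * (X * (circularJacobi l m).1))

namespace CircularJacobi

open Polynomial

/-- The circular Jacobi polynomial. -/
noncomputable def S (l : ℝ) (m : ℕ) : ℂ[X] := (circularJacobi l m).1

/-- The conjugate-reciprocal of the circular Jacobi polynomial. -/
noncomputable def V (l : ℝ) (m : ℕ) : ℂ[X] := (circularJacobi l m).2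

/-- The Gegenbauer polynomial in the variable of the unit circle, of degree `m + 1`. -/
noncomputable def G (l : ℝ) (m : ℕ) : ℂ[X] := X * S l m + V l m

/-- The multiple of `F(-n, l + 1; -n - l + 2; z)`, `n = m + 1`, without denominators. -/
noncomputable def P (l : ℝ) (m : ℕ) : ℂ[X] :=
  (C ((l : ℂ) + m + 1) * X - C ((m : ℂ) + 1)) * S l m + C (l : ℂ) * V l m

/-- The conjugate-reciprocal of `P`. -/
noncomputable def Q (l : ℝ) (m : ℕ) : ℂ[X] :=
  C (l : ℂ) * (X * S l m) + (C ((l : ℂ) + m + 1) - C ((m : ℂ) + 1) * X) * V l m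

variable (l : ℝ) (m : ℕ)

@[simp] theorem S_zero : S l 0 = 1 := rfl

@[simp] theorem V_zero : V l 0 = 1 := rfl

theorem S_succ : S l (m + 1) = C ((l : ℂ) + m + 1) * (X * S l m) + C (l : ℂ) * V l m := rfl

theorem V_succ : V l (m + 1) = C ((l : ℂ) + m + 1) * V l m + C (l : ℂ) * (X * S l m) := rfl

/-! ### Differential equations and polynomial identities -/

/-- The Szegő recursion preserves this first-order system, which serves to eliminate derivatives
from the Wronskian identities below. -/
theorem derivative_S_V :
    (1 - X) * (X * derivative (S l m))
        = (C ((l : ℂ) + m) - C (m : ℂ) * X) * S l m - C (l : ℂ) * V l m ∧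
      (1 - X) * derivative (V l m) = C (l : ℂ) * (V l m - S l m) := by
  induction m with
  | zero => simp
  | succ m ih =>
    obtain ⟨h1, h2⟩ := ih
    simp only [S_succ, V_succ, derivative_add, derivative_mul, derivative_C, derivative_X, derivative_one,
      zero_mul, zero_add, one_mul, Nat.cast_add, Nat.cast_one, C_add, C_1] at h1 h2 ⊢
    constructor
    · linear_combination (C (l : ℂ) + C (m : ℂ) + 1) * X * h1 + C (l : ℂ) * X * h2
    · linear_combination (C (l : ℂ) + C (m : ℂ) + 1) * h2 + C (l : ℂ) * h1

theorem X_mul_P_sub_Q :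
    X * P l m - Q l m = C ((l : ℂ) + m + 1) * ((X - 1) * G l m) := by
  simp only [P, Q, G, C_add, C_1]
  ring

theorem wronskian_P_Q :
    X * (derivative (P l m) * Q l m - P l m * derivative (Q l m))
      = C ((m : ℂ) + l) * (P l m * Q l m)
        + C (((l : ℂ) + m + 1) * (1 - l) * l) * G l m ^ 2 := by
  -- The system gives derivatives only after multiplication by `1 - X`, a factor cancelled by this
  -- nonvanishing.
  have hX : (1 - X : ℂ[X]) ≠ 0 := by
    intro h
    have := congrArg (eval 0) h
    simp at this
  apply mul_left_cancel₀ hX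
  obtain ⟨h1, h2⟩ := derivative_S_V l m
  have hP : (1 - X) * (X * derivative (P l m)) =
      (1 - X) * X * C ((l : ℂ) + m + 1) * S l m
      + (C ((l : ℂ) + m + 1) * X - C ((m : ℂ) + 1)) *
        ((C ((l : ℂ) + m) - C (m : ℂ) * X) * S l m - C (l : ℂ) * V l m)
      + C (l : ℂ) * X * (C (l : ℂ) * (V l m - S l m)) := by
    rw [← h1, ← h2]
    simp only [P, derivative_add, derivative_sub, derivative_mul, derivative_C, derivative_X]
    ring
  have hQ : (1 - X) * (X * derivative (Q l m)) =
      (1 - X) * X * C (l : ℂ) * S l m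
      + C (l : ℂ) * X * ((C ((l : ℂ) + m) - C (m : ℂ) * X) * S l m - C (l : ℂ) * V l m)
      - (1 - X) * X * C ((m : ℂ) + 1) * V l m
      + (C ((l : ℂ) + m + 1) - C ((m : ℂ) + 1) * X) * X * (C (l : ℂ) * (V l m - S l m)) := by
    rw [← h1, ← h2]
    simp only [Q, derivative_add, derivative_sub, derivative_mul, derivative_C, derivative_X]
    ring
  calc _ = ((1 - X) * (X * derivative (P l m))) * Q l m
        - P l m * ((1 - X) * (X * derivative (Q l m))) := by ring
    _ = _ := by
      rw [hP, hQ]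
      simp only [P, Q, G, C_add, C_sub, C_mul, C_1]
      ring

/-- The Wronskian of `X * S` and `V`. -/
noncomputable def W : ℂ[X] := derivative (X * S l m) * V l m - X * S l m * derivative (V l m)

/-- The recursion acts on the pair `X * S`, `V` by a constant matrix of determinant `(l + m + 1)² -
l² = (m + 1)(2l + m + 1)`, which multiplies the Wronskian; the product `S * V` comes from
differentiating the extra factor `X`. -/
theorem W_succ : W l (m + 1) = S l (m + 1) * V l (m + 1)
    + C ((m + 1 : ℂ) * (2 * l + m + 1)) * (X * W l m) := by
  simp only [W, S_succ, V_succ, derivative_add, derivative_mul, derivative_C, derivative_X,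
      derivative_one, C_add, C_mul, C_1, map_ofNat]
  ring

theorem P_mul_Q_sub : P l m * Q l m - C ((l : ℂ) ^ 2) * G l m ^ 2
    = - C ((m : ℂ) + 1) * ((1 - X) ^ 2 * W l m) := by
  obtain ⟨h1, h2⟩ := derivative_S_V l m
  simp only [W, P, Q, G, derivative_mul, derivative_X, C_add, C_pow, C_1] at h1 h2 ⊢
  linear_combination (C (m : ℂ) + 1) * (1 - X) * (V l m * h1 - X * S l m * h2)

/-! ### Reciprocity -/

theorem eval_V_S {z : ℂ} (hz : z ≠ 0) :
    (V l m).eval z = z ^ m * starRingEnd ℂ ((S l m).eval (1 / starRingEnd ℂ z)) ∧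
    (S l m).eval z = z ^ m * starRingEnd ℂ ((V l m).eval (1 / starRingEnd ℂ z)) := by
  induction m with
  | zero => simp
  | succ m ih =>
    obtain ⟨h1, h2⟩ := ih
    simp only [S_succ, V_succ, eval_add, eval_mul, eval_C, eval_X, h1, h2, map_add, map_mul,
      map_div₀, map_one, Complex.conj_conj, Complex.conj_ofReal, map_natCast, eval_natCast, eval_one]
    constructor <;> field_simp <;> ring

theorem eval_Q {z : ℂ} (hz : z ≠ 0) :
    (Q l m).eval z = z ^ (m + 1) * starRingEnd ℂ ((P l m).eval (1 / starRingEnd ℂ z)) := by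
  obtain ⟨h1, h2⟩ := eval_V_S l m hz
  simp only [P, Q, eval_add, eval_mul, eval_C, eval_X, eval_sub, h1, h2, map_add, map_mul, map_sub,
      map_div₀, map_one, Complex.conj_conj, Complex.conj_ofReal, map_natCast, eval_natCast, eval_one]
  field_simp
  ring

theorem conj_eq_one_div {z : ℂ} (hz : ‖z‖ = 1) : 1 / starRingEnd ℂ z = z := by
  have h0 : z ≠ 0 := by rintro rfl; simp at hz
  have h : z * starRingEnd ℂ z = 1 := by rw [Complex.mul_conj']; simp [hz]
  have : starRingEnd ℂ z ≠ 0 := by simpa using h0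
  field_simp
  rw [mul_comm, h]

theorem S_mul_V_of_norm_eq_one {z : ℂ} (hz : ‖z‖ = 1) :
    (S l m).eval z * (V l m).eval z = z ^ m * ((‖(S l m).eval z‖ ^ 2 : ℝ) : ℂ) := by
  have h0 : z ≠ 0 := by rintro rfl; simp at hz
  rw [(eval_V_S l m h0).1, conj_eq_one_div hz, mul_left_comm, Complex.mul_conj']
  push_cast; rfl

theorem P_mul_Q_of_norm_eq_one {z : ℂ} (hz : ‖z‖ = 1) :
    (P l m).eval z * (Q l m).eval z = z ^ (m + 1) * ((‖(P l m).eval z‖ ^ 2 : ℝ) : ℂ) := by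
  have h0 : z ≠ 0 := by rintro rfl; simp at hz
  rw [eval_Q l m h0, conj_eq_one_div hz, mul_left_comm, Complex.mul_conj']
  push_cast; rfl

/-- Reciprocity exchanges the two summands of `G`, so `G` is its own reciprocal in degree `m + 1`.
-/
theorem G_sq_of_norm_eq_one {z : ℂ} (hz : ‖z‖ = 1) :
    (G l m).eval z ^ 2 = z ^ (m + 1) * ((‖(G l m).eval z‖ ^ 2 : ℝ) : ℂ) := by
  have h0 : z ≠ 0 := by rintro rfl; simp at hz
  have h : (G l m).eval z = z ^ (m + 1) * starRingEnd ℂ ((G l m).eval z) := by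
    obtain ⟨h1, h2⟩ := eval_V_S l m h0
    rw [conj_eq_one_div hz] at h1 h2
    have hc : z * starRingEnd ℂ z = 1 := by rw [Complex.mul_conj']; simp [hz]
    simp only [G, eval_add, eval_mul, eval_X, map_add, map_mul]
    linear_combination z * h2 + h1 - z ^ m * starRingEnd ℂ ((S l m).eval z) * hc
  calc (G l m).eval z ^ 2 = (G l m).eval z * (z ^ (m + 1) * starRingEnd ℂ ((G l m).eval z)) := by
        rw [← h, sq]
    _ = _ := by rw [mul_left_comm, Complex.mul_conj']; push_cast; rfl

variable {l m}

/-! ### Positivity and location of zeros -/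

/-- In `W_succ`, both terms are `z ^ (m + 1)` times a nonnegative real. -/
theorem W_of_norm_eq_one (hl : 0 < l) {z : ℂ} (hz : ‖z‖ = 1) :
    ∃ t : ℝ, 0 ≤ t ∧ (W l m).eval z = z ^ m * t := by
  induction m with
  | zero => exact ⟨1, zero_le_one, by simp [W]⟩
  | succ m ih =>
    obtain ⟨t, ht, h⟩ := ih
    refine ⟨‖(S l (m + 1)).eval z‖ ^ 2 + (m + 1) * (2 * l + m + 1) * t, by positivity, ?_⟩
    rw [W_succ, eval_add, eval_mul, S_mul_V_of_norm_eq_one l _ hz, eval_mul, eval_mul, h, eval_X,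
      eval_C]
    push_cast
    ring

theorem norm_G_le_norm_P (hl : 0 < l) {z : ℂ} (hz : ‖z‖ = 1) :
    l ^ 2 * ‖(G l m).eval z‖ ^ 2 ≤ ‖(P l m).eval z‖ ^ 2 := by
  have h0 : z ≠ 0 := by rintro rfl; simp at hz
  obtain ⟨t, ht, h⟩ := W_of_norm_eq_one (m := m) hl hz
  have hc : z * starRingEnd ℂ z = 1 := by rw [Complex.mul_conj']; simp [hz]
  have key := congrArg (eval z) (P_mul_Q_sub l m)
  simp only [eval_sub, eval_mul, eval_pow, eval_C, eval_neg, eval_X, eval_one, h] at key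
  rw [P_mul_Q_of_norm_eq_one l m hz, G_sq_of_norm_eq_one l m hz] at key
  -- The minus sign here cancels the one in `P_mul_Q_sub`, so the difference becomes nonnegative.
  have hn : (1 - z) ^ 2 = - z * ((‖1 - z‖ ^ 2 : ℝ) : ℂ) := by
    push_cast
    rw [← Complex.mul_conj', map_sub, map_one]
    linear_combination -(1 - z) * hc
  rw [hn] at key
  have h2 : ((‖(P l m).eval z‖ ^ 2 - l ^ 2 * ‖(G l m).eval z‖ ^ 2 : ℝ) : ℂ)
      = ((m + 1) * ‖1 - z‖ ^ 2 * t : ℝ) := by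
    apply mul_left_cancel₀ (pow_ne_zero (m + 1) h0)
    push_cast at key ⊢
    linear_combination key
  have h3 := Complex.ofReal_injective h2
  have : 0 ≤ (m + 1) * ‖1 - z‖ ^ 2 * t := by positivity
  linarith

/-- The cross terms `2ab Re(u conj v)` agree and cancel, so the recursion preserves the order of the
two moduli. -/
theorem normSq_recursion (a b : ℝ) (u v : ℂ) :
    ‖(a : ℂ) * u + b * v‖ ^ 2 - ‖(a : ℂ) * v + b * u‖ ^ 2
      = (a ^ 2 - b ^ 2) * (‖u‖ ^ 2 - ‖v‖ ^ 2) := by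
  simp only [← Complex.normSq_eq_norm_sq, Complex.normSq_apply, Complex.add_re, Complex.add_im,
    Complex.mul_re, Complex.mul_im, Complex.ofReal_re, Complex.ofReal_im]
  ring

theorem norm_recursion_le {a b : ℝ} (hb : 0 < b) (hab : b < a) {u v : ℂ} (h : ‖v‖ ≤ ‖u‖) :
    ‖(a : ℂ) * v + b * u‖ ≤ ‖(a : ℂ) * u + b * v‖ := by
  refine le_of_sq_le_sq ?_ (norm_nonneg _)
  have := normSq_recursion a b u v
  have h2 : 0 ≤ (a ^ 2 - b ^ 2) * (‖u‖ ^ 2 - ‖v‖ ^ 2) :=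
    mul_nonneg (by nlinarith) (sub_nonneg.2 (by gcongr))
  linarith

theorem norm_recursion_lt {a b : ℝ} (hb : 0 < b) (hab : b < a) {u v : ℂ} (h : ‖v‖ < ‖u‖) :
    ‖(a : ℂ) * v + b * u‖ < ‖(a : ℂ) * u + b * v‖ := by
  refine lt_of_pow_lt_pow_left₀ 2 (norm_nonneg _) ?_
  have := normSq_recursion a b u v
  have h2 : 0 < (a ^ 2 - b ^ 2) * (‖u‖ ^ 2 - ‖v‖ ^ 2) :=
    mul_pos (by nlinarith) (sub_pos.2 (by gcongr))
  linarith

theorem norm_V_le (hl : 0 < l) {z : ℂ} (hz : 1 ≤ ‖z‖) :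
    ‖(V l m).eval z‖ ≤ ‖(S l m).eval z‖ ∧ (S l m).eval z ≠ 0 := by
  induction m with
  | zero => simp
  | succ m ih =>
    obtain ⟨h1, h2⟩ := ih
    have h3 : ‖(V l m).eval z‖ ≤ ‖z * (S l m).eval z‖ := by
      rw [norm_mul]; nlinarith [norm_nonneg ((S l m).eval z)]
    have h5 : (l : ℂ) + m + 1 = ((l + m + 1 : ℝ) : ℂ) := by push_cast; rfl
    have h4 := norm_recursion_le (a := l + m + 1) hl (by linarith [m.cast_nonneg (α := ℝ)]) h3
    simp only [S_succ, V_succ, eval_add, eval_mul, eval_C, eval_X, h5]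
    refine ⟨h4, fun h0 => ?_⟩
    have h6 : 0 < ‖z * (S l m).eval z‖ := by
      rw [norm_mul]; exact mul_pos (by linarith) (norm_pos_iff.2 h2)
    have h7 := congrArg norm (eq_neg_of_add_eq_zero_left h0)
    rw [norm_neg, norm_mul, norm_mul _ (eval z (V l m)), Complex.norm_real, Complex.norm_real,
      Real.norm_of_nonneg (by positivity), Real.norm_of_nonneg hl.le] at h7
    have : l * ‖(V l m).eval z‖ ≤ l * ‖z * (S l m).eval z‖ := by gcongr
    have : 0 < ((m : ℝ) + 1) * ‖z * (S l m).eval z‖ := by positivity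
    linarith

theorem norm_mul_S_lt (hl : 0 < l) {z : ℂ} (hz : ‖z‖ < 1) :
    ‖z * (S l m).eval z‖ < ‖(V l m).eval z‖ := by
  induction m with
  | zero => simpa
  | succ m ih =>
    have h5 : (l : ℂ) + m + 1 = ((l + m + 1 : ℝ) : ℂ) := by push_cast; rfl
    have h4 := norm_recursion_lt (a := l + m + 1) hl (by linarith [m.cast_nonneg (α := ℝ)]) ih
    simp only [S_succ, V_succ, eval_add, eval_mul, eval_C, eval_X, h5]
    refine lt_of_le_of_lt ?_ h4
    rw [norm_mul]
    exact mul_le_of_le_one_left (norm_nonneg _) hz.le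

theorem eval_S_V_one (hl : 0 < l) : ∃ t : ℝ, 0 < t ∧ (S l m).eval 1 = t ∧ (V l m).eval 1 = t := by
  induction m with
  | zero => exact ⟨1, one_pos, by simp⟩
  | succ m ih =>
    obtain ⟨t, ht, h1, h2⟩ := ih
    refine ⟨(l + m + 1) * t + l * t, by positivity, ?_⟩
    simp [S_succ, V_succ, h1, h2]

theorem norm_lt_one_of_eval_P (hl : 0 < l) {z : ℂ} (hP : (P l m).eval z = 0) : ‖z‖ < 1 := by
  by_contra! hz
  obtain ⟨h1, h2⟩ := norm_V_le (m := m) hl hz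
  have hm : (0 : ℝ) < (m : ℝ) + 1 := by positivity
  simp only [P, eval_add, eval_mul, eval_C, eval_X, eval_sub] at hP
  -- This disc is internally tangent to the unit disc at `1`, so `1 ≤ ‖z‖` leaves only `z = 1`,
  -- where `P` takes the value `2 * l * t > 0`.
  have h3 : ‖((l : ℂ) + m + 1) * z - (m + 1)‖ ≤ l := by
    have h7 := congrArg norm (eq_neg_of_add_eq_zero_left hP)
    rw [norm_neg, norm_mul, norm_mul _ (eval z (V l m)), Complex.norm_real,
      Real.norm_of_nonneg hl.le] at h7
    have h8 : l * ‖(V l m).eval z‖ ≤ l * ‖(S l m).eval z‖ := by gcongr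
    exact le_of_mul_le_mul_right (h7.trans_le h8) (norm_pos_iff.2 h2)
  have h4 : (‖((l : ℂ) + m + 1) * z - (m + 1)‖ : ℝ) ^ 2 ≤ l ^ 2 := by gcongr
  have h5 : (1 : ℝ) ≤ ‖z‖ ^ 2 := one_le_pow₀ hz
  rw [← Complex.normSq_eq_norm_sq, Complex.normSq_apply] at h4 h5
  simp only [Complex.add_re, Complex.add_im, Complex.mul_re, Complex.mul_im, Complex.ofReal_re,
    Complex.ofReal_im, Complex.sub_re, Complex.sub_im, Complex.natCast_re, Complex.natCast_im,
    Complex.one_re, Complex.one_im] at h4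
  have h6 : (1 - z.re) ^ 2 + z.im ^ 2 = 0 := by
    have ha : 0 ≤ (1 - z.re) ^ 2 + z.im ^ 2 := by positivity
    have hb : 0 < (l + m + 1) * (m + 1) := by positivity
    have hc : (l + m + 1) * (m + 1) * ((1 - z.re) ^ 2 + z.im ^ 2)
        + (l + m + 1) * l * (z.re * z.re + z.im * z.im - 1) ≤ 0 := by
      linarith
    have hd : 0 ≤ (l + m + 1) * l * (z.re * z.re + z.im * z.im - 1) :=
      mul_nonneg (by positivity) (by linarith)
    nlinarith
  have hz1 : z = 1 := by
    apply Complex.ext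
    · simp only [Complex.one_re]; nlinarith [sq_nonneg (1 - z.re), sq_nonneg z.im]
    · simp only [Complex.one_im]; nlinarith [sq_nonneg (1 - z.re), sq_nonneg z.im]
  obtain ⟨t, ht, h8, h9⟩ := eval_S_V_one (m := m) hl
  rw [hz1, h8, h9] at hP
  have h10 : ((2 * l * t : ℝ) : ℂ) = 0 := by push_cast; linear_combination hP
  have : 0 < 2 * l * t := by positivity
  exact this.ne' (by exact_mod_cast h10)

end CircularJacobi

namespace CircularJacobi

open Polynomial

/-! ### Coefficients -/

/-- The coefficient `(x)_k / k!` of the binomial series. -/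
noncomputable def binomCoeff (x : ℂ) (k : ℕ) : ℂ := (ascPochhammer ℂ k).eval x / (k.factorial : ℂ)

theorem binomCoeff_zero (x : ℂ) : binomCoeff x 0 = 1 := by simp [binomCoeff]

theorem binomCoeff_succ (x : ℂ) (k : ℕ) :
    ((k : ℂ) + 1) * binomCoeff x (k + 1) = (x + k) * binomCoeff x k := by
  have h : (k.factorial : ℂ) ≠ 0 := by exact_mod_cast k.factorial_ne_zero
  have h' : (k : ℂ) + 1 ≠ 0 := by exact_mod_cast k.succ_ne_zero
  rw [binomCoeff, binomCoeff, ascPochhammer_succ_eval, Nat.factorial_succ]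
  push_cast
  field_simp

theorem binomCoeff_succ_left (x : ℂ) (k : ℕ) :
    ((k : ℂ) + 1) * binomCoeff x (k + 1) = x * binomCoeff (x + 1) k := by
  have h : (k.factorial : ℂ) ≠ 0 := by exact_mod_cast k.factorial_ne_zero
  have h' : (k : ℂ) + 1 ≠ 0 := by exact_mod_cast k.succ_ne_zero
  rw [binomCoeff, binomCoeff, ascPochhammer_succ_left, Nat.factorial_succ, eval_mul, eval_comp]
  simp only [eval_X, eval_add, eval_one]
  push_cast
  field_simp

theorem binomCoeff_sub (x : ℂ) (k : ℕ) :
    binomCoeff x (k + 1) - binomCoeff x k = binomCoeff (x - 1) (k + 1) := by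
  have h' : (k : ℂ) + 1 ≠ 0 := by exact_mod_cast k.succ_ne_zero
  have h1 := binomCoeff_succ_left (x - 1) k
  rw [sub_add_cancel] at h1
  apply mul_left_cancel₀ h'
  linear_combination binomCoeff_succ x k - h1

variable (l : ℝ)

theorem coeff_eq_zero (m k : ℕ) (h : m < k) : (S l m).coeff k = 0 ∧ (V l m).coeff k = 0 := by
  induction m generalizing k with
  | zero => simp [coeff_one, h.ne']
  | succ m ih =>
    obtain _ | k := k
    · omega
    have h1 := ih k (by omega)
    have h2 := ih (k + 1) (by omega)
    simp only [S_succ, V_succ, coeff_add, coeff_C_mul, coeff_X_mul, h1, h2]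
    simp

/-- Equivalently, `S l m / m!` is the coefficient of `t ^ m` in `(1 - zt)^(-l-1) (1 - t)^(-l)`; for
`V` the two exponents are exchanged. -/
theorem coeff_S_V (m k j : ℕ) (h : k + j = m) :
    (S l m).coeff k = m.factorial * (binomCoeff (l + 1) k * binomCoeff l j) ∧
    (V l m).coeff k = m.factorial * (binomCoeff l k * binomCoeff (l + 1) j) := by
  induction m generalizing k j with
  | zero =>
    obtain ⟨rfl, rfl⟩ : k = 0 ∧ j = 0 := by omega
    simp [binomCoeff_zero]
  | succ m ih =>
    rw [S_succ, V_succ, Nat.factorial_succ]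
    simp only [coeff_add, coeff_C_mul]
    obtain _ | k := k
    · obtain rfl : j = m + 1 := by omega
      obtain ⟨h1, h2⟩ := ih 0 m (by omega)
      simp only [coeff_X_mul_zero, h2, binomCoeff_zero]
      push_cast
      constructor
      · linear_combination -(m.factorial : ℂ) * binomCoeff_succ_left l m
      · linear_combination -(m.factorial : ℂ) * binomCoeff_succ (l + 1) m
    have hk : (k : ℂ) + 1 ≠ 0 := by exact_mod_cast k.succ_ne_zero
    have a1 := binomCoeff_succ (l + 1) k
    have a2 := binomCoeff_succ_left l k
    obtain _ | j := j
    · obtain rfl : k = m := by omega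
      obtain ⟨h1, -⟩ := ih k 0 (by omega)
      obtain ⟨-, h4⟩ := coeff_eq_zero l k (k + 1) (by omega)
      simp only [coeff_X_mul, h1, h4, binomCoeff_zero]
      push_cast
      constructor
      · linear_combination -(k.factorial : ℂ) * a1
      · linear_combination -(k.factorial : ℂ) * a2
    · obtain ⟨h1, -⟩ := ih k (j + 1) (by omega)
      obtain ⟨-, h2⟩ := ih (k + 1) j (by omega)
      have hj : (j : ℂ) + 1 ≠ 0 := by exact_mod_cast j.succ_ne_zero
      have b1 := binomCoeff_succ (l + 1) j
      have b2 := binomCoeff_succ_left l j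
      obtain rfl : m = k + j + 1 := by omega
      simp only [coeff_X_mul, h1, h2]
      -- Everything is reduced to `binomCoeff (l + 1) k` and `binomCoeff (l + 1) j`, leaving a
      -- rational identity.
      have e1 : binomCoeff (l + 1) (k + 1) = (l + 1 + k) * binomCoeff (l + 1) k / (k + 1) := by
        field_simp; linear_combination a1
      have e2 : binomCoeff l (k + 1) = l * binomCoeff (l + 1) k / (k + 1) := by
        field_simp; linear_combination a2
      have e3 : binomCoeff (l + 1) (j + 1) = (l + 1 + j) * binomCoeff (l + 1) j / (j + 1) := by
        field_simp; linear_combination b1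
      have e4 : binomCoeff l (j + 1) = l * binomCoeff (l + 1) j / (j + 1) := by
        field_simp; linear_combination b2
      rw [e1, e2, e3, e4]
      push_cast
      constructor
      · field_simp
        ring
      · field_simp
        ring

theorem P_eq (m : ℕ) : P l m = S l (m + 1) - C ((m : ℂ) + 1) * S l m := by
  rw [P, S_succ]
  ring

/-- By `P_eq`, passing to `P` multiplies the generating function by `1 - t`, which lowers the second
parameter from `l` to `l - 1`. -/
theorem coeff_P (m k j : ℕ) (h : k + j = m + 1) :
    (P l m).coeff k = (m + 1).factorial * (binomCoeff (l + 1) k * binomCoeff (l - 1) j) := by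
  rw [P_eq, coeff_sub, coeff_C_mul, (coeff_S_V l (m + 1) k j h).1]
  obtain _ | j := j
  · rw [(coeff_eq_zero l m k (by omega)).1]
    simp [binomCoeff_zero]
  · rw [(coeff_S_V l m k j (by omega)).1, ← binomCoeff_sub, Nat.factorial_succ]
    push_cast
    ring

theorem coeff_P_eq_zero (m k : ℕ) (h : m + 1 < k) : (P l m).coeff k = 0 := by
  rw [P_eq, coeff_sub, coeff_C_mul, (coeff_eq_zero l (m + 1) k h).1,
    (coeff_eq_zero l m k (by omega)).1]
  simp

theorem ascPochhammer_eval_reverse (x : ℂ) (n k j : ℕ) (h : k + j = n) :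
    (ascPochhammer ℂ k).eval (-(n : ℂ) - x + 1) * (ascPochhammer ℂ j).eval x
      = (-1) ^ k * (ascPochhammer ℂ n).eval x := by
  induction k generalizing j with
  | zero => simp [← h]
  | succ k ih =>
    have h1 := ih (j + 1) (by omega)
    rw [ascPochhammer_succ_eval] at h1 ⊢
    have h2 : (n : ℂ) = k + 1 + j := by rw [← h]; push_cast; ring
    rw [pow_succ]
    have h3 : -(n : ℂ) - x + 1 + k = -(x + j) := by rw [h2]; ring
    rw [h3]
    linear_combination -h1

theorem ascPochhammer_eval_ne_zero {ν : ℝ} (hν : -1 < ν) (hν0 : ν ≠ 0) (k : ℕ) :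
    (ascPochhammer ℂ k).eval (ν : ℂ) ≠ 0 := by
  rw [Ne, ascPochhammer_eval_eq_zero_iff]
  rintro ⟨i, -, hi⟩
  have h : (i : ℝ) = -ν := by exact_mod_cast hi
  obtain rfl | hi0 := Nat.eq_zero_or_pos i
  · exact hν0 (by simpa using h.symm)
  · have : (1 : ℝ) ≤ i := by exact_mod_cast hi0
    linarith

theorem conj_ascPochhammer_eval (x : ℝ) (k : ℕ) :
    starRingEnd ℂ ((ascPochhammer ℂ k).eval (x : ℂ)) = (ascPochhammer ℂ k).eval (x : ℂ) := by
  induction k with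
  | zero => simp
  | succ k ih => simp [ascPochhammer_succ_eval, ih]

theorem coeff_hyperPoly (n : ℕ) (b c : ℂ) (k : ℕ) :
    (hyperPoly n b c).coeff k
      = if k ≤ n then ordinaryHypergeometricCoefficient (-(n : ℂ)) b c k else 0 := by
  simp [hyperPoly, coeff_monomial]

theorem P_eq_hyperPoly {ν : ℝ} (hν : -1 < ν) (hν0 : ν ≠ 0) (m : ℕ) :
    P (ν + 1) m = C ((ascPochhammer ℂ (m + 1)).eval (ν : ℂ)) *
      hyperPoly (m + 1) ((ν : ℂ) + 2) (-((m + 1 : ℕ) : ℂ) - (ν : ℂ) + 1) := by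
  ext k
  rw [coeff_C_mul, coeff_hyperPoly]
  split_ifs with h
  · obtain ⟨j, hj⟩ := Nat.exists_eq_add_of_le h
    rw [coeff_P _ _ k j hj.symm, ordinaryHypergeometricCoefficient, binomCoeff, binomCoeff]
    have h1 := ascPochhammer_eval_reverse (ν : ℂ) (m + 1) k j hj.symm
    -- At `x = 1` reversal reads `(-n)_k j! = (-1)^k n!`; the sign cancels against that of
    -- `(-n-ν+1)_k`.
    have h2 := ascPochhammer_eval_reverse 1 (m + 1) k j hj.symm
    rw [sub_add_cancel, ascPochhammer_eval_one, ascPochhammer_eval_one] at h2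
    have hn := ascPochhammer_eval_ne_zero hν hν0 (m + 1)
    have hj0 := ascPochhammer_eval_ne_zero hν hν0 j
    have hkf : (k.factorial : ℂ) ≠ 0 := by exact_mod_cast k.factorial_ne_zero
    have hjf : (j.factorial : ℂ) ≠ 0 := by exact_mod_cast j.factorial_ne_zero
    have hs : ((-1 : ℂ) ^ k) ≠ 0 := by simp
    have e1 := eq_div_of_mul_eq hj0 h1
    have e2 := eq_div_of_mul_eq hjf h2
    rw [e1, e2]
    have e3 : ((ν + 1 : ℝ) : ℂ) + 1 = ν + 2 := by push_cast; ring
    have e4 : ((ν + 1 : ℝ) : ℂ) - 1 = ν := by push_cast; ring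
    rw [e3, e4]
    field_simp
  · rw [coeff_P_eq_zero _ _ _ (by omega), mul_zero]

end CircularJacobi

/-! ### Blaschke factorisation from the location of the zeros. -/

open Polynomial in
theorem isBlaschkeProduct_of_norm_root_lt_one {n : ℕ} {p : ℂ[X]} (hp : p ≠ 0)
    (hn : p.natDegree = n) (hroot : ∀ z, p.eval z = 0 → ‖z‖ < 1) :
    IsBlaschkeProduct n (fun z => p.eval z / (conjReciprocal n p).eval z) := by
  have hs := IsAlgClosed.splits p
  -- The roots are listed with multiplicity.
  obtain ⟨f, hf⟩ : ∃ f : Fin n → ℂ, p.roots = Multiset.map f Finset.univ.val := by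
    obtain ⟨L, hL⟩ := Quot.exists_rep p.roots
    have hc : L.length = n := by
      rw [← hn, hs.natDegree_eq_card_roots, ← hL]; rfl
    subst hc
    refine ⟨L.get, ?_⟩
    rw [← hL, Fin.univ_val_map, List.ofFn_get]
    rfl
  have hev : ∀ z, p.eval z = p.leadingCoeff * ∏ i, (z - f i) := by
    intro z
    conv_lhs => rw [hs.eq_prod_roots, hf]
    rw [eval_mul, eval_C, Multiset.map_map]
    change _ * eval z (∏ i, (X - C (f i))) = _
    simp [eval_prod]
  have hl : p.leadingCoeff ≠ 0 := leadingCoeff_ne_zero.2 hp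
  have hq : ∀ z, (conjReciprocal n p).eval z
      = starRingEnd ℂ p.leadingCoeff * ∏ i, (1 - starRingEnd ℂ (f i) * z) := by
    intro z
    obtain rfl | hz := eq_or_ne z 0
    · rw [← coeff_zero_eq_eval_zero, conjReciprocal, coeff_reflect, coeff_map, revAt_zero,
        leadingCoeff, hn]
      simp
    · rw [eval_conjReciprocal n p hn.le hz, hev, map_mul, map_prod, mul_left_comm]
      congr 1
      have : z ^ n = ∏ _i : Fin n, z := by simp
      rw [this, ← Finset.prod_mul_distrib]
      refine Finset.prod_congr rfl fun i _ => ?_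
      simp only [map_sub, map_div₀, map_one, Complex.conj_conj]
      field_simp
  refine ⟨p.leadingCoeff / starRingEnd ℂ p.leadingCoeff, f, ?_, fun k => hroot _ ?_, fun z => ?_⟩
  · rw [norm_div, Complex.norm_conj, div_self (norm_ne_zero_iff.2 hl)]
  · rw [hev, Finset.prod_eq_zero (Finset.mem_univ k) (sub_self _), mul_zero]
  · beta_reduce
    rw [hev, hq, Finset.prod_div_distrib, mul_div_mul_comm]

/-! ### The derivative on the unit circle and the extreme set. -/

namespace CircularJacobi

open Polynomial

variable {ν : ℝ} {m : ℕ}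

theorem coeff_G (l : ℝ) : (G l m).coeff (m + 1) = m.factorial * binomCoeff (l + 1) m := by
  rw [G, coeff_add, coeff_X_mul, (coeff_S_V l m m 0 rfl).1, (coeff_eq_zero l m _ m.lt_succ_self).2,
    binomCoeff_zero]
  simp

/-- `G` has positive degree, hence a root; at a root `|zS| = |V|`. Inside the disc `|zS| < |V|`,
outside `|zS| > |V|`, and `G(1) > 0`. -/
theorem exists_root_G {l : ℝ} (hl : 0 < l) :
    ∃ z, ‖z‖ = 1 ∧ z ≠ 1 ∧ (G l m).eval z = 0 := by
  have hc : (G l m).coeff (m + 1) ≠ 0 := by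
    rw [coeff_G, binomCoeff]
    have h1 : (m.factorial : ℂ) ≠ 0 := by exact_mod_cast m.factorial_ne_zero
    have h2 := ascPochhammer_eval_ne_zero (ν := l + 1) (by linarith) (by linarith) m
    push_cast at h2
    positivity
  have hd : (G l m).degree ≠ 0 := fun h => by
    have := le_degree_of_ne_zero hc
    rw [h] at this
    exact absurd (WithBot.coe_le_coe.1 this) (by simp)
  obtain ⟨z, hz⟩ := IsAlgClosed.exists_root _ hd
  have hz' : z * (S l m).eval z + (V l m).eval z = 0 := by simpa [G, IsRoot] using hz
  have hn : ‖z * (S l m).eval z‖ = ‖(V l m).eval z‖ := by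
    rw [eq_neg_of_add_eq_zero_left hz', norm_neg]
  refine ⟨z, ?_, ?_, hz⟩
  · rcases lt_trichotomy ‖z‖ 1 with h | h | h
    · exact absurd hn (norm_mul_S_lt hl h).ne
    · exact h
    · obtain ⟨h1, h2⟩ := norm_V_le (m := m) hl h.le
      rw [norm_mul] at hn
      have := norm_pos_iff.2 h2
      nlinarith
  · rintro rfl
    obtain ⟨t, ht, h1, h2⟩ := eval_S_V_one (m := m) hl
    rw [h1, h2] at hz'
    have : ((2 * t : ℝ) : ℂ) = 0 := by push_cast; linear_combination hz'
    have : 2 * t = 0 := by exact_mod_cast this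
    linarith

theorem natDegree_hyperPoly_le (n : ℕ) (b c : ℂ) : (hyperPoly n b c).natDegree ≤ n := by
  rw [natDegree_le_iff_coeff_eq_zero]
  intro k hk
  rw [coeff_hyperPoly, if_neg (by omega)]

theorem eval_hyperPoly_eq (hν : -1 < ν) (hν0 : ν ≠ 0) (z : ℂ) :
    (hyperPoly (m + 1) ((ν : ℂ) + 2) (-((m + 1 : ℕ) : ℂ) - (ν : ℂ) + 1)).eval z
      = (P (ν + 1) m).eval z / (ascPochhammer ℂ (m + 1)).eval (ν : ℂ) := by
  rw [P_eq_hyperPoly hν hν0, eval_C_mul,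
    mul_div_cancel_left₀ _ (ascPochhammer_eval_ne_zero hν hν0 (m + 1))]

/-- The normalising factor `(ν)_n` is real, so it is the same in the reciprocal and cancels. -/
theorem hyperBlaschke_eq (hν : -1 < ν) (hν0 : ν ≠ 0) {z : ℂ} (hz : z ≠ 0) :
    hyperBlaschke (m + 1) ((ν : ℂ) + 2) (-((m + 1 : ℕ) : ℂ) - (ν : ℂ) + 1) z
      = (P (ν + 1) m).eval z / (Q (ν + 1) m).eval z := by
  rw [hyperBlaschke, eval_conjReciprocal _ _ (natDegree_hyperPoly_le _ _ _) hz, eval_Q _ _ hz,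
    eval_hyperPoly_eq hν hν0, eval_hyperPoly_eq hν hν0, map_div₀, conj_ascPochhammer_eval,
    ← mul_div_assoc, div_div_div_cancel_right₀ (ascPochhammer_eval_ne_zero hν hν0 (m + 1))]

theorem isHyperBlaschke (hν : -1 < ν) (hν0 : ν ≠ 0) :
    IsHyperBlaschke (m + 1) ((ν : ℂ) + 2) (-((m + 1 : ℕ) : ℂ) - (ν : ℂ) + 1) := by
  have hc := ascPochhammer_eval_ne_zero hν hν0 (m + 1)
  have hroot : ∀ z, (hyperPoly (m + 1) ((ν : ℂ) + 2)
      (-((m + 1 : ℕ) : ℂ) - (ν : ℂ) + 1)).eval z = 0 → ‖z‖ < 1 := by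
    intro z hz
    refine norm_lt_one_of_eval_P (l := ν + 1) (m := m) (by linarith) ?_
    rw [P_eq_hyperPoly hν hν0, eval_C_mul, hz, mul_zero]
  have hcoeff : (hyperPoly (m + 1) ((ν : ℂ) + 2)
      (-((m + 1 : ℕ) : ℂ) - (ν : ℂ) + 1)).coeff (m + 1) ≠ 0 := by
    intro h
    have h1 := congrArg (coeff · (m + 1)) (P_eq_hyperPoly hν hν0 m)
    simp only [coeff_C_mul, h, mul_zero, coeff_P _ _ (m + 1) 0 rfl, binomCoeff_zero] at h1
    have h2 := ascPochhammer_eval_ne_zero (ν := ν + 1 + 1) (by linarith) (by linarith) (m + 1)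
    have h3 : (((m + 1).factorial : ℕ) : ℂ) ≠ 0 := by exact_mod_cast (m + 1).factorial_ne_zero
    rw [binomCoeff, mul_one, mul_div_cancel₀ _ h3] at h1
    exact h2 (by push_cast at h1 ⊢; exact h1)
  refine ⟨fun k hk h => ?_, hroot, isBlaschkeProduct_of_norm_root_lt_one ?_ ?_ hroot⟩
  -- A vanishing denominator would mean `ν = k - m` with `k ≤ m`: either `ν = 0` or `ν ≤ -1`.
  · have h1 : ((ν + m : ℝ) : ℂ) = ((k : ℝ) : ℂ) := by push_cast at h ⊢; linear_combination -h
    have h2 : ν + m = k := Complex.ofReal_injective h1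
    have h3 : (k : ℝ) ≤ m := by exact_mod_cast Nat.lt_succ_iff.1 hk
    obtain h4 | h4 := (Nat.lt_succ_iff.1 hk).eq_or_lt
    · exact hν0 (by rw [h4] at h2; linarith)
    · have : (k : ℝ) + 1 ≤ m := by exact_mod_cast h4
      linarith
  · intro h
    rw [h] at hcoeff
    simp at hcoeff
  · exact le_antisymm (natDegree_hyperPoly_le _ _ _) (le_natDegree_of_ne_zero hcoeff)

theorem norm_deriv_quotient {l : ℝ} (hl : 0 < l) {z : ℂ} (hz : ‖z‖ = 1) :
    ‖deriv (fun w => (P l m).eval w / (Q l m).eval w) z‖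
      = (m + l) + (l + m + 1) * (1 - l) / l *
        (l ^ 2 * ‖(G l m).eval z‖ ^ 2 / ‖(P l m).eval z‖ ^ 2) := by
  have h0 : z ≠ 0 := by rintro rfl; simp at hz
  have hP : (P l m).eval z ≠ 0 := fun h => (norm_lt_one_of_eval_P hl h).ne hz
  have hPn : 0 < ‖(P l m).eval z‖ := norm_pos_iff.2 hP
  have hQn : ‖(Q l m).eval z‖ = ‖(P l m).eval z‖ := by
    rw [eval_Q l m h0, conj_eq_one_div hz, norm_mul, norm_pow, hz, one_pow, one_mul,
      Complex.norm_conj]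
  have hQ : (Q l m).eval z ≠ 0 := norm_pos_iff.1 (hQn ▸ hPn)
  have hle := norm_G_le_norm_P (m := m) hl hz
  have hw := congrArg (eval z) (wronskian_P_Q l m)
  simp only [eval_add, eval_mul, eval_sub, eval_C, eval_X, eval_pow] at hw
  rw [P_mul_Q_of_norm_eq_one l m hz, G_sq_of_norm_eq_one l m hz] at hw
  set p := ‖(P l m).eval z‖
  set g := ‖(G l m).eval z‖
  rw [deriv_fun_div (P l m).differentiableAt (Q l m).differentiableAt hQ,
    Polynomial.deriv, Polynomial.deriv, norm_div, norm_pow, hQn]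
  set D := eval z (derivative (P l m)) * eval z (Q l m)
    - eval z (P l m) * eval z (derivative (Q l m))
  have h1 : z * D = z ^ (m + 1) *
      (((m + l) * p ^ 2 + (l + m + 1) * (1 - l) * l * g ^ 2 : ℝ) : ℂ) := by
    rw [hw]; push_cast; ring
  have h2 : ‖D‖ = |(m + l) * p ^ 2 + (l + m + 1) * (1 - l) * l * g ^ 2| := by
    have := congrArg norm h1
    rwa [norm_mul, norm_mul, norm_pow, hz, one_pow, one_mul, one_mul, Complex.norm_real,
      Real.norm_eq_abs] at this
  -- The coefficient `1 - l` may be negative; regrouping around `p ^ 2 - l ^ 2 * g ^ 2 ≥ 0` shows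
  -- that the absolute value can be dropped.
  have h3 : 0 ≤ l * ((m + l) * p ^ 2 + (l + m + 1) * (1 - l) * l * g ^ 2) := by
    have e : l * ((m + l) * p ^ 2 + (l + m + 1) * (1 - l) * l * g ^ 2)
        = l * (m + l) * (p ^ 2 - l ^ 2 * g ^ 2) + (m + 1) * (l ^ 2 * g ^ 2) := by ring
    rw [e]
    have : 0 ≤ p ^ 2 - l ^ 2 * g ^ 2 := by linarith
    positivity
  rw [h2, abs_of_nonneg (nonneg_of_mul_nonneg_right h3 hl)]
  field_simp

/-- On the unit circle `|B'|` is a convex combination of `n + ν` and `n / (ν + 1)`. -/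
theorem norm_deriv_hyperBlaschke (hν : -1 < ν) (hν0 : ν ≠ 0) {z : ℂ} (hz : ‖z‖ = 1) :
    ∃ t : ℝ, 0 ≤ t ∧ t ≤ 1 ∧
      t = (ν + 1) ^ 2 * ‖(G (ν + 1) m).eval z‖ ^ 2 / ‖(P (ν + 1) m).eval z‖ ^ 2 ∧
      ‖deriv (hyperBlaschke (m + 1) ((ν : ℂ) + 2) (-((m + 1 : ℕ) : ℂ) - (ν : ℂ) + 1)) z‖
        = (1 - t) * ((m + 1 : ℕ) + ν) + t * ((m + 1 : ℕ) / (ν + 1)) := by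
  have hl : 0 < ν + 1 := by linarith
  have h0 : z ≠ 0 := by rintro rfl; simp at hz
  refine ⟨_, by positivity, div_le_one_of_le₀ (norm_G_le_norm_P hl hz) (by positivity), rfl, ?_⟩
  have he : hyperBlaschke (m + 1) ((ν : ℂ) + 2) (-((m + 1 : ℕ) : ℂ) - (ν : ℂ) + 1)
      =ᶠ[nhds z] fun w => (P (ν + 1) m).eval w / (Q (ν + 1) m).eval w := by
    filter_upwards [isOpen_ne.mem_nhds h0] with w hw using hyperBlaschke_eq hν hν0 hw
  rw [he.deriv_eq, norm_deriv_quotient hl hz]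
  push_cast
  generalize (ν + 1) ^ 2 * ‖(G (ν + 1) m).eval z‖ ^ 2 / ‖(P (ν + 1) m).eval z‖ ^ 2 = t
  field_simp
  ring

theorem mem_extremeSet_iff (hν : -1 < ν) (hν0 : ν ≠ 0) {z : ℂ} :
    z ∈ extremeSet (hyperBlaschke (m + 1) ((ν : ℂ) + 2) (-((m + 1 : ℕ) : ℂ) - (ν : ℂ) + 1)) ↔
      ‖z‖ = 1 ∧ (z = 1 ∨ (G (ν + 1) m).eval z = 0) := by
  have hl : 0 < ν + 1 := by linarith
  rw [extremeSet, Set.mem_ofPred_eq, mem_sphere_zero_iff_norm]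
  refine and_congr_right fun hz => ?_
  have h0 : z ≠ 0 := by rintro rfl; simp at hz
  have hP : (P (ν + 1) m).eval z ≠ 0 := fun h => (norm_lt_one_of_eval_P hl h).ne hz
  have hQ : (Q (ν + 1) m).eval z ≠ 0 := by
    intro h
    have := P_mul_Q_of_norm_eq_one (ν + 1) m hz
    rw [h, mul_zero] at this
    have h2 := (mul_eq_zero.1 this.symm).resolve_left (pow_ne_zero _ h0)
    have h3 : ‖(P (ν + 1) m).eval z‖ ^ 2 = 0 := by exact_mod_cast h2
    exact hP (by simpa using h3)
  have hx := congrArg (eval z) (X_mul_P_sub_Q (ν + 1) m)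
  simp only [eval_mul, eval_sub, eval_C, eval_X, eval_one] at hx
  have hc : ((ν + 1 : ℝ) : ℂ) + m + 1 ≠ 0 := by
    have : ν + 1 + m + 1 ≠ 0 := by positivity
    exact_mod_cast this
  rw [hyperBlaschke_eq hν hν0 h0, ← mul_div_assoc, div_eq_one_iff_eq hQ, ← sub_eq_zero, hx,
    mul_eq_zero, or_iff_right hc, mul_eq_zero, sub_eq_zero]

end CircularJacobi

/-! ### Extremal values and the points attaining them. -/

open CircularJacobi in
theorem theorem3 (n : ℕ) (hn : 1 ≤ n) (ν : ℝ) (hν : -1 < ν) (hν0 : ν ≠ 0)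
    (B : ℂ → ℂ) (hB : B = hyperBlaschke n ((ν : ℂ) + 2) (-(n : ℂ) - (ν : ℂ) + 1)) :
    IsHyperBlaschke n ((ν : ℂ) + 2) (-(n : ℂ) - (ν : ℂ) + 1) ∧
    (0 < ν → maxDeriv B = n + ν ∧ minDeriv B = n / (ν + 1)) ∧
    (ν < 0 → maxDeriv B = n / (ν + 1) ∧ minDeriv B = n + ν) ∧
    (∃ z ∈ extremeSet B, ‖deriv B z‖ = maxDeriv B) ∧
    (∃ z ∈ extremeSet B, ‖deriv B z‖ = minDeriv B) ∧
    (∀ z ∈ extremeSet B \ {1}, ‖deriv B z‖ = n + ν) ∧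
    (1 : ℂ) ∈ extremeSet B ∧ ‖deriv B 1‖ = n / (ν + 1) := by
  obtain ⟨m, rfl⟩ : ∃ m, n = m + 1 := ⟨n - 1, by omega⟩
  have hl : 0 < ν + 1 := by linarith
  subst hB
  set B := hyperBlaschke (m + 1) ((ν : ℂ) + 2) (-((m + 1 : ℕ) : ℂ) - (ν : ℂ) + 1) with hB
  have h1mem : (1 : ℂ) ∈ extremeSet B := (mem_extremeSet_iff hν hν0).2 ⟨by simp, Or.inl rfl⟩
  have hE : ∀ z ∈ extremeSet B \ {1}, ‖deriv B z‖ = (m + 1 : ℕ) + ν := by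
    rintro z ⟨hz, hz1⟩
    obtain ⟨hz, h⟩ := (mem_extremeSet_iff hν hν0).1 hz
    obtain ⟨t, -, -, ht, hd⟩ := norm_deriv_hyperBlaschke (m := m) hν hν0 hz
    rw [h.resolve_left hz1] at ht
    have ht0 : t = 0 := by simpa using ht
    rw [hd, ht0]
    ring
  have h1 : ‖deriv B 1‖ = (m + 1 : ℕ) / (ν + 1) := by
    obtain ⟨t, -, -, ht, hd⟩ := norm_deriv_hyperBlaschke (m := m) (z := 1) hν hν0 (by simp)
    have ht1 : t = 1 := by
      have hP : (P (ν + 1) m).eval 1 ≠ 0 := fun h => (norm_lt_one_of_eval_P hl h).ne (by simp)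
      -- At `1` the factor of `S` in `P` reduces to `l`, the same as that of `V`.
      have he : (P (ν + 1) m).eval 1 = ((ν + 1 : ℝ) : ℂ) * (G (ν + 1) m).eval 1 := by
        simp [P, G]
        ring
      rw [ht, he, norm_mul, Complex.norm_real, Real.norm_of_nonneg hl.le, mul_pow, div_self]
      rw [he] at hP
      have h2 := norm_pos_iff.2 (right_ne_zero_of_mul hP)
      positivity
    rw [hd, ht1]
    ring
  obtain ⟨w, hw, hw1, hwG⟩ := exists_root_G (m := m) hl
  have hwE : w ∈ extremeSet B := (mem_extremeSet_iff hν hν0).2 ⟨hw, Or.inr hwG⟩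
  have hwd := hE w ⟨hwE, hw1⟩
  have hmem : ∀ z ∈ extremeSet B,
      ‖deriv B z‖ ∈ (fun z => ‖deriv B z‖) '' Metric.sphere (0 : ℂ) 1 :=
    fun z hz => ⟨z, hz.1, rfl⟩
  -- The gap between the endpoints of the convex combination has the sign of `ν`.
  have hdiff : (((m + 1 : ℕ) : ℝ) + ν) - (m + 1 : ℕ) / (ν + 1)
      = ν * ((m + 1 : ℕ) + ν + 1) / (ν + 1) := by
    field_simp
    ring
  have hpos : (0 : ℝ) < (m + 1 : ℕ) + ν + 1 := by
    have : (0 : ℝ) ≤ ((m + 1 : ℕ) : ℝ) := Nat.cast_nonneg _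
    linarith
  have hgt : 0 < ν → maxDeriv B = (m + 1 : ℕ) + ν ∧ minDeriv B = (m + 1 : ℕ) / (ν + 1) := by
    intro h
    have hle : ((m + 1 : ℕ) : ℝ) / (ν + 1) ≤ (m + 1 : ℕ) + ν :=
      sub_nonneg.1 (hdiff ▸ by positivity)
    constructor
    · refine IsGreatest.csSup_eq ⟨hwd ▸ hmem w hwE, ?_⟩
      rintro _ ⟨z, hz, rfl⟩
      obtain ⟨t, ht0, ht1, -, hd⟩ :=
        norm_deriv_hyperBlaschke (m := m) hν hν0 (mem_sphere_zero_iff_norm.1 hz)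
      simp only [hB, hd]
      nlinarith
    · refine IsLeast.csInf_eq ⟨h1 ▸ hmem 1 h1mem, ?_⟩
      rintro _ ⟨z, hz, rfl⟩
      obtain ⟨t, ht0, ht1, -, hd⟩ :=
        norm_deriv_hyperBlaschke (m := m) hν hν0 (mem_sphere_zero_iff_norm.1 hz)
      simp only [hB, hd]
      nlinarith
  have hlt : ν < 0 → maxDeriv B = (m + 1 : ℕ) / (ν + 1) ∧ minDeriv B = (m + 1 : ℕ) + ν := by
    intro h
    have hle : (m + 1 : ℕ) + ν ≤ ((m + 1 : ℕ) : ℝ) / (ν + 1) := by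
      refine sub_nonpos.1 (hdiff ▸ ?_)
      exact div_nonpos_of_nonpos_of_nonneg (mul_nonpos_of_nonpos_of_nonneg h.le hpos.le) hl.le
    constructor
    · refine IsGreatest.csSup_eq ⟨h1 ▸ hmem 1 h1mem, ?_⟩
      rintro _ ⟨z, hz, rfl⟩
      obtain ⟨t, ht0, ht1, -, hd⟩ :=
        norm_deriv_hyperBlaschke (m := m) hν hν0 (mem_sphere_zero_iff_norm.1 hz)
      simp only [hB, hd]
      nlinarith
    · refine IsLeast.csInf_eq ⟨hwd ▸ hmem w hwE, ?_⟩
      rintro _ ⟨z, hz, rfl⟩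
      obtain ⟨t, ht0, ht1, -, hd⟩ :=
        norm_deriv_hyperBlaschke (m := m) hν hν0 (mem_sphere_zero_iff_norm.1 hz)
      simp only [hB, hd]
      nlinarith
  refine ⟨isHyperBlaschke hν hν0, hgt, hlt, ?_, ?_, hE, h1mem, h1⟩
  · obtain h | h := lt_or_gt_of_ne hν0
    · exact ⟨1, h1mem, h1.trans (hlt h).1.symm⟩
    · exact ⟨w, hwE, hwd.trans (hgt h).1.symm⟩
  · obtain h | h := lt_or_gt_of_ne hν0
    · exact ⟨w, hwE, hwd.trans (hlt h).2.symm⟩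
    · exact ⟨1, h1mem, h1.trans (hgt h).2.symm⟩
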